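/- Theorem 4.3 (Rupprecht). Let $A\subseteq\mathbb N$ be an oracle. The following are equivalent. (i) There is a total function $f:\mathbb N\to\mathbb N$ with $f\le_T A$ such that for every total computable function $g:\mathbb N\to\mathbb N$ we have $f(n)\neq g(n)$ for all but finitely many $n$. (ii) $A$ is weakly meager engulfing, that is, there is an $A$-effectively meager set $\mathcal S\subseteq 2^{\mathbb N}$ that contains all computable elements of Cantor space $2^{\mathbb N}$. (ii') $A$ is weakly meager engulfing in the sense of Baire space, that is, there is an $A$-effectively meager set $\mathcal S\subseteq\mathbb N^{\mathbb N}$ that contains all computable elements of Baire space $\mathbb N^{\mathbb N}$. Here, for $X=2^{\mathbb N}$ or $X=\mathbb N^{\mathbb N}$ with the product topology of discrete spaces, a set $\mathcal S\subseteq X$ is called $A$-effectively meager if $\mathcal S\subseteq\bigcup_m\mathcal C_m$ for some sequence $(\mathcal C_m)_{m\in\mathbb N}$ of nowhere dense subsets of $X$ that are uniformly $\Pi^0_1(A)$, which means that there is a set $W$ of pairs $(m,\sigma)$ of a number $m$ and a finite string $\sigma$, recursively enumerable relative to $A$, such that for all $m$ the complement of $\mathcal C_m$ is the set of all $x\in X$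 that extend some $\sigma$ with $(m,\sigma)\in W$. -/

import Mathlib

/-- The characteristic function of a set of natural numbers, as an oracle. -/
noncomputable def oracleOf (A : Set ℕ) : ℕ →. ℕ :=
  ((A.indicator fun _ => 1 : ℕ → ℕ) : ℕ →. ℕ)

/-- A total function on the natural numbers is Turing reducible to the oracle `A`. -/
def ReducibleToSet (f : ℕ → ℕ) (A : Set ℕ) : Prop :=
  TuringReducible (f : ℕ →. ℕ) (oracleOf A)

/-- `f` eventually disagrees with `g`: `f n ≠ g n` for all but finitely many `n`. -/
def EventuallyDisagree (f g : ℕ → ℕ) : Prop :=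
  ∀ᶠ n in Filter.atTop, f n ≠ g n

/-- `A` computes a total function that eventually disagrees with every total computable
function. -/
def ComputesEventuallyDisagreeing (A : Set ℕ) : Prop :=
  ∃ f : ℕ → ℕ, ReducibleToSet f A ∧ ∀ g : ℕ → ℕ, Computable g → EventuallyDisagree f g

/-- `p` is recursively enumerable relative to `A`: it is the domain of a partial function that is
recursive in `A` (the relativization of `REPred`). -/
def REPredInSet {β : Type*} [Primcodable β] (A : Set ℕ) (p : β → Prop) : Prop :=
  RecursiveIn {oracleOf A} fun b => Part.assert (p b) fun _ => Part.some ()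

/-- The basic clopen set `[σ]` of all infinite sequences extending the string `σ`. -/
def stringCylinder {α : Type*} (σ : List α) : Set (ℕ → α) :=
  {x | ∀ (i : ℕ) (hi : i < σ.length), x i = σ[i]}

/-- The classes `C 0, C 1, …` of infinite sequences are uniformly `Π⁰₁` relative to `A`: their
complements are the open sets generated, uniformly in `m`, by an `A`-r.e. set of strings. -/
def UniformlyPiZeroOne {α : Type*} [Primcodable α] (A : Set ℕ) (C : ℕ → Set (ℕ → α)) : Prop :=
  ∃ W : ℕ × List α → Prop, REPredInSet A W ∧
    ∀ m, (C m)ᶜ = ⋃ σ ∈ {σ : List α | W (m, σ)}, stringCylinder σ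

/-- `S` is `A`-effectively meager: it is contained in a union of nowhere dense classes that are
uniformly `Π⁰₁` relative to `A`. The space `ℕ → α` carries the product topology. -/
def EffectivelyMeagerIn {α : Type*} [Primcodable α] [TopologicalSpace α]
    (A : Set ℕ) (S : Set (ℕ → α)) : Prop :=
  ∃ C : ℕ → Set (ℕ → α), UniformlyPiZeroOne A C ∧ (∀ m, IsNowhereDense (C m)) ∧ S ⊆ ⋃ m, C m

/-- `A` is weakly meager engulfing in the space `ℕ → α` (Cantor space for `α = Bool`, Baire space
for `α = ℕ`): some `A`-effectively meager set contains all computable points. -/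
def WeaklyMeagerEngulfing (α : Type*) [Primcodable α] [TopologicalSpace α] (A : Set ℕ) : Prop :=
  ∃ S : Set (ℕ → α), EffectivelyMeagerIn A S ∧ ∀ x : ℕ → α, Computable x → x ∈ S

/-!
Fix a letter `a`, and let a sequence `x` propose at `n` the waiting time from position `n` until
`a` next occurs. A computable `x` proposes a computable function, or else `a` occurs only finitely
often. So if `f` eventually disagrees with all computable functions, then every computable `x` lies
in one of the sets of those `x` that do not propose `f n` at any `n ≥ m`; these are nowhere dense
and uniformly `Π⁰₁` in `f`.

Conversely, suppose that every `A`-computable function agrees infinitely often with a computable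
one, and consider nowhere dense classes `C m`, uniformly `Π⁰₁` in `A`. Some `A`-computable strings
`T n` are universal: appended to any string with code at most `n`, `T n` leads out of `C m` for all
`m ≤ n`. A computable point outside all `C m` is built as the limit of strings `p k`, extended by
guesses at `T (ν k)`, where the computable sequence `ν` bounds the codes of the `p k`. For this one
guesses first a `ν` so sparse that infinitely often the correct extension respects the bound, and
then `T ∘ ν`, correctly infinitely often among those `k`. The latter works for any infinite
`A`-decidable set of arguments: guess at stage `n` the values at `n + 1` of its elements beyond `n`;
since at most `n` arguments were served before, one of these is still free.
-/

open Encodable Filter Topology TopologicalSpace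

section ComputableIn

variable {α β γ σ : Type*} [Primcodable α] [Primcodable β] [Primcodable γ] [Primcodable σ]
variable {O : Set (ℕ →. ℕ)}

theorem recursiveIn_bind {f : α →. β} {g : β →. σ} (hf : RecursiveIn O f) (hg : RecursiveIn O g) :
    RecursiveIn O fun a => (f a).bind g :=
  (Nat.RecursiveIn.comp hg hf).of_eq fun n => by
    rcases decode (α := α) n with - | a
    · simp
    · simpa [encodek] using (Part.map_bind g (f a) encode).symm

theorem recursiveIn_rfind {p : α → ℕ → Bool} (hp : ComputableIn₂ O p) :
    RecursiveIn O fun a => Nat.rfind fun n => Part.some (p a n) := by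
  have hp' : RecursiveIn O fun q : α × ℕ => (Part.some (p q.1 q.2)).bind
      fun b => Part.some (cond b 0 1) :=
    recursiveIn_bind hp (Primrec.dom_bool fun b => cond b 0 1).computableIn
  refine (Nat.RecursiveIn.rfind hp').of_eq fun n => ?_
  rcases e : decode (α := α) n with - | a
  · simpa [e] using Nat.rfind_zero_none (fun _ => Part.none) rfl
  · have hcond (b : Bool) : decide (cond b 0 1 = 0) = b := by cases b <;> rfl
    simp [e, Part.map_id', hcond]

attribute [fun_prop] ComputableIn

@[fun_prop]
theorem computableIn_id : ComputableIn O fun a : α => a :=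
  Primrec.id.computableIn

@[fun_prop]
theorem computableIn_const (b : β) : ComputableIn O fun _ : α => b :=
  (Primrec.const b).computableIn

@[fun_prop]
theorem computableIn_comp {f : β → σ} {g : α → β} (hf : ComputableIn O f)
    (hg : ComputableIn O g) : ComputableIn O fun a => f (g a) :=
  (recursiveIn_bind hg hf).of_eq fun _ => Part.bind_some _ _

@[fun_prop]
theorem computableIn_prodMk {f : α → β} {g : α → γ} (hf : ComputableIn O f)
    (hg : ComputableIn O g) : ComputableIn O fun a => (f a, g a) :=
  (Nat.RecursiveIn.pair hf hg).of_eq fun n => by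
    rcases decode (α := α) n <;> simp [Seq.seq]

theorem computableIn_primrec₂ {F : β → γ → σ} (hF : Primrec₂ F) {f : α → β} {g : α → γ}
    (hf : ComputableIn O f) (hg : ComputableIn O g) : ComputableIn O fun a => F (f a) (g a) :=
  computableIn_comp hF.computableIn (computableIn_prodMk hf hg)

@[fun_prop]
theorem computableIn_fst : ComputableIn O (Prod.fst : α × β → α) :=
  Primrec.fst.computableIn

@[fun_prop]
theorem computableIn_snd : ComputableIn O (Prod.snd : α × β → β) :=
  Primrec.snd.computableIn

@[fun_prop]
theorem computableIn_add {f g : α → ℕ} (hf : ComputableIn O f) (hg : ComputableIn O g) :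
    ComputableIn O fun a => f a + g a :=
  computableIn_primrec₂ Primrec.nat_add hf hg

@[fun_prop]
theorem computableIn_mul {f g : α → ℕ} (hf : ComputableIn O f) (hg : ComputableIn O g) :
    ComputableIn O fun a => f a * g a :=
  computableIn_primrec₂ Primrec.nat_mul hf hg

@[fun_prop]
theorem computableIn_max {f g : α → ℕ} (hf : ComputableIn O f) (hg : ComputableIn O g) :
    ComputableIn O fun a => max (f a) (g a) :=
  computableIn_primrec₂ Primrec.nat_max hf hg

@[fun_prop]
theorem computableIn_unpair : ComputableIn O Nat.unpair :=
  Primrec.unpair.computableIn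

@[fun_prop]
theorem computableIn_encode : ComputableIn O (encode : α → ℕ) :=
  Primrec.encode.computableIn

@[fun_prop]
theorem computableIn_decode : ComputableIn O (decode : ℕ → Option α) :=
  Primrec.decode.computableIn

@[fun_prop]
theorem computableIn_option_getD {f : α → Option β} {g : α → β} (hf : ComputableIn O f)
    (hg : ComputableIn O g) : ComputableIn O fun a => (f a).getD (g a) :=
  computableIn_primrec₂ Primrec.option_getD hf hg

-- Not tagged `fun_prop`: unifying `decide (_ = _)` with `decide (_ ≤ _)` unfolds the instances.
theorem computableIn_decide_eq [DecidableEq β] {f g : α → β} (hf : ComputableIn O f)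
    (hg : ComputableIn O g) : ComputableIn O fun a => decide (f a = g a) :=
  computableIn_primrec₂ Primrec.eq.decide hf hg

@[fun_prop]
theorem computableIn_decide_le {f g : α → ℕ} (hf : ComputableIn O f) (hg : ComputableIn O g) :
    ComputableIn O fun a => decide (f a ≤ g a) :=
  computableIn_primrec₂ Primrec.nat_le.decide hf hg

@[fun_prop]
theorem computableIn_and {f g : α → Bool} (hf : ComputableIn O f) (hg : ComputableIn O g) :
    ComputableIn O fun a => (f a && g a) :=
  computableIn_primrec₂ Primrec.and hf hg

@[fun_prop]
theorem computableIn_ite {c : α → Prop} [DecidablePred c] {f g : α → β}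
    (hc : ComputableIn O fun a => decide (c a)) (hf : ComputableIn O f) (hg : ComputableIn O g) :
    ComputableIn O fun a => if c a then f a else g a := by
  have hcond : Primrec₂ fun (b : Bool) (p : β × β) => cond b p.1 p.2 :=
    Primrec.cond Primrec.fst (Primrec.fst.comp Primrec.snd) (Primrec.snd.comp Primrec.snd)
  simpa only [Bool.cond_decide] using computableIn_primrec₂ hcond hc (computableIn_prodMk hf hg)

@[fun_prop]
theorem computableIn_append {f g : α → List β} (hf : ComputableIn O f) (hg : ComputableIn O g) :
    ComputableIn O fun a => f a ++ g a :=
  computableIn_primrec₂ Primrec.list_append hf hg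

@[fun_prop]
theorem computableIn_length : ComputableIn O (List.length : List α → ℕ) :=
  Primrec.list_length.computableIn

@[fun_prop]
theorem computableIn_drop {f : α → ℕ} {g : α → List β} (hf : ComputableIn O f)
    (hg : ComputableIn O g) : ComputableIn O fun a => (g a).drop (f a) :=
  computableIn_primrec₂ Primrec.list_drop hf hg

@[fun_prop]
theorem computableIn_take {f : α → ℕ} {g : α → List β} (hf : ComputableIn O f)
    (hg : ComputableIn O g) : ComputableIn O fun a => (g a).take (f a) :=
  computableIn_primrec₂ Primrec.list_take hf hg

@[fun_prop]
theorem computableIn_idxOf [DecidableEq β] {f : α → β} {g : α → List β} (hf : ComputableIn O f)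
    (hg : ComputableIn O g) : ComputableIn O fun a => (g a).idxOf (f a) :=
  computableIn_primrec₂ Primrec.list_idxOf hf hg

@[fun_prop]
theorem computableIn_lookup [DecidableEq β] {f : α → β} {g : α → List (β × γ)}
    (hf : ComputableIn O f) (hg : ComputableIn O g) :
    ComputableIn O fun a => (g a).lookup (f a) :=
  computableIn_primrec₂ Primrec.listLookup hf hg

@[fun_prop]
theorem computableIn_nat_rec {f : α → ℕ} {g : α → σ} {h : α → ℕ → σ → σ}
    (hf : ComputableIn O f) (hg : ComputableIn O g)
    (hh : ComputableIn O fun q : α × ℕ × σ => h q.1 q.2.1 q.2.2) :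
    ComputableIn O fun a => Nat.rec (motive := fun _ => σ) (g a) (h a) (f a) :=
  (Nat.RecursiveIn.comp (Nat.RecursiveIn.prec hg hh)
    (computableIn_prodMk computableIn_id hf)).of_eq fun n => by
    rcases decode (α := α) n with - | a
    · simp
    · simp only [Part.coe_some, Part.bind_some, Part.map_some, encode_prod_val, Part.bind_eq_bind,
        Nat.unpair_pair, encodek]
      induction f a <;> simp_all [encodek]

@[fun_prop]
theorem computableIn_range_map {f : α → ℕ} {g : α → ℕ → σ} (hf : ComputableIn O f)
    (hg : ComputableIn O fun p : α × ℕ => g p.1 p.2) :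
    ComputableIn O fun a => (List.range (f a)).map (g a) := by
  have hrec : ComputableIn O fun a =>
      Nat.rec (motive := fun _ => List σ) [] (fun n l => l ++ [g a n]) (f a) := by
    have : ComputableIn O fun b : σ => [b] :=
      computableIn_primrec₂ Primrec.list_cons computableIn_id (computableIn_const [])
    fun_prop
  refine (funext fun a => ?_ : _ = fun a => (List.range (f a)).map (g a)) ▸ hrec
  induction f a <;> simp_all [List.range_succ]

theorem exists_computableIn_least {p : α → ℕ → Bool} (hp : ComputableIn₂ O p)
    (H : ∀ a, ∃ n, p a n) :
    ∃ f : α → ℕ, ComputableIn O f ∧ ∀ a, p a (f a) ∧ ∀ m < f a, ¬ p a m := by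
  classical
  refine ⟨fun a => Nat.find (H a), ?_, fun a => ⟨Nat.find_spec (H a), fun m => Nat.find_min (H a)⟩⟩
  refine (recursiveIn_rfind hp).of_eq_tot fun a => Nat.mem_rfind.2 ⟨?_, fun {m} hm => ?_⟩
  · simpa using Nat.find_spec (H a)
  · simpa using Nat.find_min (H a) hm

theorem exists_computableIn_choice [Inhabited β] {p : α → β → Bool} (hp : ComputableIn₂ O p)
    (H : ∀ a, ∃ b, p a b) : ∃ f : α → β, ComputableIn O f ∧ ∀ a, p a (f a) := by
  have hp' : ComputableIn O p.uncurry := hp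
  have hq : ComputableIn O fun q : α × ℕ => p.uncurry (q.1, (decode q.2).getD default) := by
    fun_prop
  obtain ⟨f, hf, hpf⟩ := exists_computableIn_least (p := fun a n => p a ((decode n).getD default))
    hq fun a => (H a).imp' encode fun b hb => by simpa using hb
  exact ⟨fun a => (decode (f a)).getD default, by fun_prop, fun a => (hpf a).1⟩

end ComputableIn

section UsePrinciple

variable {a : ℕ → ℕ} {f h : ℕ →. ℕ} {F H : List ℕ → ℕ →. ℕ}

/-- `F` computes `f` from finite pieces of the oracle `a`: given an initial segment of `a`, it
outputs only correct values of `f`, and outputs each of them once the segment is long enough. -/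
structure ComputesFromPrefixes (a : ℕ → ℕ) (F : List ℕ → ℕ →. ℕ) (f : ℕ →. ℕ) : Prop where
  partrec : Partrec₂ F
  sound : ∀ {k n x}, x ∈ F ((List.range k).map a) n → x ∈ f n
  complete : ∀ {n x}, x ∈ f n → ∀ᶠ k in atTop, x ∈ F ((List.range k).map a) n

namespace ComputesFromPrefixes

theorem of_partrec (hf : Partrec f) : ComputesFromPrefixes a (fun _ => f) f where
  partrec := hf.comp Computable.snd
  sound h := h
  complete h := .of_forall fun _ => h

theorem oracle : ComputesFromPrefixes a (fun σ n => (σ[n]? : Part ℕ)) a where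
  partrec := Primrec.list_getElem?.to_comp.ofOption
  sound {k n x} hx := by
    obtain ⟨m, hm, rfl⟩ : ∃ m, (List.range k)[n]? = some m ∧ a m = x := by simpa using hx
    obtain ⟨hn, rfl⟩ := List.getElem?_eq_some_iff.1 hm
    simp
  complete {n _} h := by
    filter_upwards [eventually_gt_atTop n] with k hk
    simp_all

theorem comp (hf : ComputesFromPrefixes a F f) (hh : ComputesFromPrefixes a H h) :
    ComputesFromPrefixes a (fun σ n => H σ n >>= F σ) (fun n => h n >>= f) where
  partrec := hh.partrec.bind (hf.partrec.comp (Computable.fst.comp .fst) .snd).to₂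
  sound hx := by
    obtain ⟨y, hy, hx⟩ := Part.mem_bind_iff.1 hx
    exact Part.mem_bind_iff.2 ⟨y, hh.sound hy, hf.sound hx⟩
  complete hx := by
    obtain ⟨y, hy, hx⟩ := Part.mem_bind_iff.1 hx
    filter_upwards [hh.complete hy, hf.complete hx] with k h₁ h₂
    exact Part.mem_bind_iff.2 ⟨y, h₁, h₂⟩

theorem pair (hf : ComputesFromPrefixes a F f) (hh : ComputesFromPrefixes a H h) :
    ComputesFromPrefixes a (fun σ n => Nat.pair <$> F σ n <*> H σ n)
      (fun n => Nat.pair <$> f n <*> h n) where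
  partrec := by
    refine Partrec.of_eq (f := fun p : List ℕ × ℕ =>
      (F p.1 p.2).bind fun x => (H p.1 p.2).map (Nat.pair x)) ?_ fun p => by simp [Seq.seq]
    have hH : Partrec fun q : (List ℕ × ℕ) × ℕ => H q.1.1 q.1.2 := Partrec.comp hh.partrec .fst
    exact Partrec.bind hf.partrec (hH.map
      (Primrec₂.natPair.to_comp.comp (Computable.snd.comp .fst) .snd).to₂)
  sound := by
    simp only [Seq.seq, Part.mem_bind_iff, Part.map_eq_map, Part.mem_map_iff]
    rintro k n x ⟨_, ⟨y, hy, rfl⟩, z, hz, rfl⟩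
    exact ⟨_, ⟨y, hf.sound hy, rfl⟩, z, hh.sound hz, rfl⟩
  complete := by
    simp only [Seq.seq, Part.mem_bind_iff, Part.map_eq_map, Part.mem_map_iff]
    rintro n x ⟨_, ⟨y, hy, rfl⟩, z, hz, rfl⟩
    filter_upwards [hf.complete hy, hh.complete hz] with k hy hz
    exact ⟨_, ⟨y, hy, rfl⟩, z, hz, rfl⟩

theorem prec (hf : ComputesFromPrefixes a F f) (hh : ComputesFromPrefixes a H h) :
    ComputesFromPrefixes a
      (fun σ p => Nat.rec (motive := fun _ => Part ℕ) (F σ p.unpair.1)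
        (fun y IH => IH.bind fun i => H σ (Nat.pair p.unpair.1 (Nat.pair y i))) p.unpair.2)
      (fun p => Nat.rec (motive := fun _ => Part ℕ) (f p.unpair.1)
        (fun y IH => IH.bind fun i => h (Nat.pair p.unpair.1 (Nat.pair y i))) p.unpair.2) where
  partrec := by
    have hleft : Computable fun p : List ℕ × ℕ => p.2.unpair.1 :=
      Computable.fst.comp (Computable.unpair.comp .snd)
    have hright : Computable fun p : List ℕ × ℕ => p.2.unpair.2 :=
      Computable.snd.comp (Computable.unpair.comp .snd)
    have harg : Computable fun q : (List ℕ × ℕ) × ℕ × ℕ =>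
        Nat.pair q.1.2.unpair.1 (Nat.pair q.2.1 q.2.2) :=
      Primrec₂.natPair.to_comp.comp (hleft.comp .fst) (Primrec₂.natPair.to_comp.comp
        (Computable.fst.comp .snd) (Computable.snd.comp .snd))
    exact Partrec.nat_rec hright (hf.partrec.comp .fst hleft)
      (hh.partrec.comp (Computable.fst.comp .fst) harg).to₂
  sound {k p x} := by
    induction p.unpair.2 generalizing x with
    | zero => exact hf.sound
    | succ n ih =>
      intro hx
      obtain ⟨y, hy, hx⟩ := Part.mem_bind_iff.1 hx
      exact Part.mem_bind_iff.2 ⟨y, ih hy, hh.sound hx⟩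
  complete {p x} := by
    induction p.unpair.2 generalizing x with
    | zero => exact hf.complete
    | succ n ih =>
      intro hx
      obtain ⟨y, hy, hx⟩ := Part.mem_bind_iff.1 hx
      filter_upwards [ih hy, hh.complete hx] with k h₁ h₂
      exact Part.mem_bind_iff.2 ⟨y, h₁, h₂⟩

theorem rfind (hf : ComputesFromPrefixes a F f) :
    ComputesFromPrefixes a
      (fun σ b => Nat.rfind fun n => (fun m => decide (m = 0)) <$> F σ (Nat.pair b n))
      (fun b => Nat.rfind fun n => (fun m => decide (m = 0)) <$> f (Nat.pair b n)) where
  partrec := by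
    have harg : Computable fun q : (List ℕ × ℕ) × ℕ => Nat.pair q.1.2 q.2 :=
      Primrec₂.natPair.to_comp.comp (Computable.snd.comp .fst) .snd
    have hzero : Computable fun q : ((List ℕ × ℕ) × ℕ) × ℕ => decide (q.2 = 0) :=
      (Primrec.eq.decide.comp Primrec.snd (Primrec.const 0)).to_comp
    exact Partrec.rfind ((hf.partrec.comp (Computable.fst.comp .fst) harg).map hzero.to₂).to₂
  sound {k b x} hx := by
    obtain ⟨h₀, hlt⟩ := Nat.mem_rfind.1 hx
    refine Nat.mem_rfind.2 ⟨(Part.mem_map_iff _).2 ?_, fun hj => (Part.mem_map_iff _).2 ?_⟩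
    · exact ((Part.mem_map_iff _).1 h₀).imp fun _ => .imp_left hf.sound
    · exact ((Part.mem_map_iff _).1 (hlt hj)).imp fun _ => .imp_left hf.sound
  complete {b x} hx := by
    obtain ⟨h₀, hlt⟩ := Nat.mem_rfind.1 hx
    have hmap {n : ℕ} {v : Bool}
        (h : v ∈ (fun m => decide (m = 0)) <$> f (Nat.pair b n)) : ∀ᶠ k in atTop,
        v ∈ (fun m => decide (m = 0)) <$> F ((List.range k).map a) (Nat.pair b n) := by
      obtain ⟨m, hm, hv⟩ := (Part.mem_map_iff _).1 h
      filter_upwards [hf.complete hm] with k hk using (Part.mem_map_iff _).2 ⟨m, hk, hv⟩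
    have hlt' := (eventually_all_finset (Finset.range x)).2 fun j hj =>
      hmap (hlt (Finset.mem_range.1 hj))
    filter_upwards [hmap h₀, hlt'] with k h₀ hlt
    exact Nat.mem_rfind.2 ⟨h₀, fun hj => hlt _ (Finset.mem_range.2 hj)⟩

end ComputesFromPrefixes

theorem exists_computesFromPrefixes (hf : Nat.RecursiveIn {(a : ℕ →. ℕ)} f) :
    ∃ F, ComputesFromPrefixes a F f := by
  induction hf with
  | zero => exact ⟨_, .of_partrec (Computable.const 0)⟩
  | succ => exact ⟨_, .of_partrec Computable.succ⟩
  | left => exact ⟨_, .of_partrec (Computable.fst.comp .unpair)⟩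
  | right => exact ⟨_, .of_partrec (Computable.snd.comp .unpair)⟩
  | oracle g hg => exact Set.mem_singleton_iff.1 hg ▸ ⟨_, .oracle⟩
  | pair _ _ hf hh => exact ⟨_, hf.choose_spec.pair hh.choose_spec⟩
  | comp _ _ hf hh => exact ⟨_, hf.choose_spec.comp hh.choose_spec⟩
  | prec _ _ hf hh => exact ⟨_, hf.choose_spec.prec hh.choose_spec⟩
  | rfind _ hf => exact ⟨_, hf.choose_spec.rfind⟩

theorem exists_computable_dom_iff {α σ : Type*} [Primcodable α] [Primcodable σ] {f : α →. σ}
    (hf : Partrec f) : ∃ R : α → ℕ → Bool, Computable₂ R ∧ ∀ x, (f x).Dom ↔ ∃ t, R x t := by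
  obtain ⟨c, hc⟩ := Nat.Partrec.Code.exists_code.1 hf
  refine ⟨fun x t => (c.evaln t (encode x)).isSome, ?_, fun x => ?_⟩
  · have harg : Primrec fun p : α × ℕ => ((p.2, c), encode p.1) :=
      (Primrec.snd.pair (Primrec.const c)).pair (Primrec.encode.comp Primrec.fst)
    exact (Primrec.option_isSome.comp (Nat.Partrec.Code.primrec_evaln.comp harg)).to_comp
  · have heval : c.eval (encode x) = (f x).map encode := by simp [hc]
    have hdom : (f x).Dom ↔ ∃ y, y ∈ c.eval (encode x) := by
      rw [← Part.dom_iff_mem, heval]; rfl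
    simp only [hdom, Nat.Partrec.Code.evaln_complete, Option.isSome_iff_exists]
    exact exists_comm

theorem exists_computableIn_dom_iff {α σ : Type*} [Primcodable α] [Primcodable σ] {f : α →. σ}
    (hf : RecursiveIn {(a : ℕ →. ℕ)} f) :
    ∃ R : α → ℕ → Bool, ComputableIn₂ {(a : ℕ →. ℕ)} R ∧ ∀ x, (f x).Dom ↔ ∃ s, R x s := by
  obtain ⟨F, hF⟩ := exists_computesFromPrefixes hf
  obtain ⟨R, hR, hFR⟩ := exists_computable_dom_iff hF.partrec
  have hR' := hR.computableIn (O := {(a : ℕ →. ℕ)})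
  have ha : ComputableIn {(a : ℕ →. ℕ)} a := RecursiveIn.oracle _ rfl
  refine ⟨fun x s => R ((List.range s.unpair.1).map a, encode x) s.unpair.2, ?_, fun x => ?_⟩
  · unfold ComputableIn₂
    fun_prop
  · have hdom : (f x).Dom ↔ ∃ k, (F ((List.range k).map a) (encode x)).Dom := by
      simp only [Part.dom_iff_mem]
      constructor
      · rintro ⟨y, hy⟩
        have hmem : encode y ∈
            Part.bind (decode (α := α) (encode x)) fun x => (f x).map encode := by
          simpa using Part.mem_map encode hy
        exact (hF.complete hmem).exists.imp fun k hk => ⟨_, hk⟩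
      · rintro ⟨k, z, hz⟩
        obtain ⟨y, hy, -⟩ : ∃ y ∈ f x, encode y = z := by simpa using hF.sound hz
        exact ⟨y, hy⟩
    simp only [hdom, fun k => hFR ((List.range k).map a, encode x)]
    exact ⟨fun ⟨k, t, h⟩ => ⟨Nat.pair k t, by simpa using h⟩, fun ⟨s, h⟩ => ⟨_, _, h⟩⟩

theorem rePredInSet_iff_exists {β : Type*} [Primcodable β] {A : Set ℕ} {p : β → Prop} :
    REPredInSet A p ↔
      ∃ R : β → ℕ → Bool, ComputableIn₂ {oracleOf A} R ∧ ∀ b, p b ↔ ∃ s, R b s := by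
  constructor
  · intro hp
    obtain ⟨R, hR, h⟩ := exists_computableIn_dom_iff hp
    exact ⟨R, hR, fun b => by simpa [Part.assert] using h b⟩
  · rintro ⟨R, hR, h⟩
    refine (recursiveIn_bind (recursiveIn_rfind hR) (computableIn_const ())).of_eq fun b => ?_
    have hdom : (Nat.rfind fun n => Part.some (R b n)).Dom ↔ p b := by
      simpa [h b] using Nat.rfind_dom (p := fun n => Part.some (R b n))
    exact Part.ext fun _ => by simp [← Part.dom_iff_mem, hdom]

end UsePrinciple

section StringCylinder

variable {α : Type*}

theorem mem_stringCylinder_range_map (x : ℕ → α) (n : ℕ) :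
    x ∈ stringCylinder ((List.range n).map x) := by
  simp [stringCylinder]

theorem range_map_eq_of_mem_stringCylinder {σ : List α} {x : ℕ → α} (h : x ∈ stringCylinder σ) :
    (List.range σ.length).map x = σ :=
  List.ext_getElem (by simp) fun i _ hi => by simpa using h i hi

theorem getD_mem_stringCylinder (σ : List α) (x : ℕ → α) :
    (fun i => σ.getD i (x i)) ∈ stringCylinder σ := fun i hi => by
  simp [hi]

theorem stringCylinder_anti {σ τ : List α} (h : σ <+: τ) :
    stringCylinder τ ⊆ stringCylinder σ := fun x hx i hi => by
  rw [hx i (hi.trans_le h.length_le), h.getElem hi]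

theorem exists_isPrefix_append_of_mem_stringCylinder {σ ρ : List α} {x : ℕ → α}
    (hσ : x ∈ stringCylinder σ) (hρ : x ∈ stringCylinder ρ) : ∃ τ, ρ <+: σ ++ τ := by
  have hσ' := range_map_eq_of_mem_stringCylinder hσ
  have hρ' := range_map_eq_of_mem_stringCylinder hρ
  have hx : (List.range (σ.length + ρ.length)).map x =
      σ ++ (List.range ρ.length).map (fun i => x (σ.length + i)) := by
    rw [List.range_add, List.map_append, hσ', List.map_map]
    rfl
  refine ⟨(List.range ρ.length).map fun i => x (σ.length + i), ?_⟩
  rw [← hx, add_comm, List.range_add, List.map_append, hρ']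
  exact List.prefix_append _ _

theorem stringCylinder_range_map_eq_cylinder (x : ℕ → α) (n : ℕ) :
    stringCylinder ((List.range n).map x) = PiNat.cylinder x n := by
  ext y
  simp [stringCylinder, PiNat.cylinder]

variable [TopologicalSpace α] [DiscreteTopology α] [Nonempty α]

theorem isTopologicalBasis_stringCylinder :
    IsTopologicalBasis (Set.range (stringCylinder (α := α))) := by
  convert PiNat.isTopologicalBasis_cylinders fun _ : ℕ => α using 1
  ext U
  constructor
  · rintro ⟨σ, rfl⟩
    have hσ :=
      range_map_eq_of_mem_stringCylinder (getD_mem_stringCylinder σ (Classical.arbitrary _))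
    exact ⟨_, _, by rw [← stringCylinder_range_map_eq_cylinder, hσ]⟩
  · rintro ⟨x, n, rfl⟩
    exact ⟨_, stringCylinder_range_map_eq_cylinder x n⟩

theorem isNowhereDense_iff_of_compl_eq {C : Set (ℕ → α)} {V : Set (List α)}
    (hC : Cᶜ = ⋃ σ ∈ V, stringCylinder σ) :
    IsNowhereDense C ↔ ∀ σ, ∃ x ∈ stringCylinder σ, x ∉ C := by
  have hbasis := isTopologicalBasis_stringCylinder (α := α)
  have hclosed : IsClosed C := by
    rw [← isOpen_compl_iff, hC]
    exact isOpen_biUnion fun σ _ => hbasis.isOpen ⟨σ, rfl⟩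
  rw [hclosed.isNowhereDense_iff, interior_eq_empty_iff_dense_compl, hbasis.dense_iff]
  simp only [Set.forall_mem_range]
  exact forall_congr' fun σ => forall_prop_of_true
    ⟨_, getD_mem_stringCylinder σ (Classical.arbitrary _)⟩

end StringCylinder

section Engulfing

variable {α : Type*} {a : α} {x : ℕ → α} {n k : ℕ}

/-- The number `k` is the waiting time at `n` until `a` next occurs in the sequence `x`. This is
how a point of sequence space codes a value of a function at `n`. -/
def IsWaitingTime (a : α) (x : ℕ → α) (n k : ℕ) : Prop :=
  x (n + k) = a ∧ ∀ i < k, x (n + i) ≠ a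

theorem IsWaitingTime.unique {k' : ℕ} (h : IsWaitingTime a x n k) (h' : IsWaitingTime a x n k') :
    k = k' :=
  le_antisymm (not_lt.1 fun hlt => h.2 _ hlt h'.1) (not_lt.1 fun hlt => h'.2 _ hlt h.1)

theorem isWaitingTime_iff_exists_string [DecidableEq α] : IsWaitingTime a x n k ↔
    ∃ σ : List α, (n + k < σ.length ∧ (σ.drop n).idxOf a = k) ∧ x ∈ stringCylinder σ := by
  have hstring {σ : List α} (hσ : x ∈ stringCylinder σ) (hlen : n + k < σ.length) :
      IsWaitingTime a x n k ↔ (σ.drop n).idxOf a = k := by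
    have hk : k < (σ.drop n).length := by simp; omega
    have hx {i : ℕ} (hi : i ≤ k) : (σ.drop n)[i]'(hi.trans_lt hk) = x (n + i) := by
      rw [List.getElem_drop, hσ (n + i) (by omega)]
    rw [List.idxOf, List.findIdx_eq hk, IsWaitingTime, hx le_rfl]
    refine and_congr (by simp) (forall₂_congr fun i hi => ?_)
    rw [hx hi.le]
    simp
  refine ⟨fun h => ⟨(List.range (n + k + 1)).map x, ⟨by simp, ?_⟩,
    mem_stringCylinder_range_map x _⟩, fun ⟨σ, ⟨hlen, hk⟩, hσ⟩ => (hstring hσ hlen).2 hk⟩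
  exact (hstring (mem_stringCylinder_range_map x _) (by simp)).1 h

variable [Primcodable α]

theorem exists_forall_not_isWaitingTime {f : ℕ → ℕ}
    (hf : ∀ g : ℕ → ℕ, Computable g → EventuallyDisagree f g) (hx : Computable x) :
    ∃ m, ∀ n ≥ m, ¬ IsWaitingTime a x n (f n) := by
  classical
  by_cases h : ∀ n, ∃ k, x (n + k) = a
  · have hx' : ComputableIn ∅ x := hx.computableIn
    have hp : ComputableIn ∅ fun q : ℕ × ℕ => decide (x (q.1 + q.2) = a) :=
      computableIn_decide_eq (by fun_prop) (by fun_prop)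
    obtain ⟨g, hg, hxg⟩ := exists_computableIn_least
      (p := fun n k => decide (x (n + k) = a)) hp (by simpa using h)
    obtain ⟨m, hm⟩ := eventually_atTop.1 (hf g (recursiveIn_empty_iff.1 hg))
    exact ⟨m, fun n hn hw => hm n hn (hw.unique (by simpa using! hxg n))⟩
  · push Not at h
    obtain ⟨m, hm⟩ := h
    refine ⟨m, fun n hn hw => hm (n - m + f n) ?_⟩
    rw [← hw.1]
    congr 1
    omega

theorem ComputesEventuallyDisagreeing.weaklyMeagerEngulfing [Nontrivial α] [TopologicalSpace α]
    [DiscreteTopology α] {A : Set ℕ} (h : ComputesEventuallyDisagreeing A) :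
    WeaklyMeagerEngulfing α A := by
  classical
  obtain ⟨f, hfA, hf⟩ := h
  obtain ⟨a, b, hab⟩ := exists_pair_ne α
  let C : ℕ → Set (ℕ → α) := fun m => {x | ∀ n ≥ m, ¬ IsWaitingTime a x n (f n)}
  let W : ℕ × List α → Prop := fun p =>
    ∃ n, p.1 ≤ n ∧ n + f n < p.2.length ∧ (p.2.drop n).idxOf a = f n
  have hC (m : ℕ) : (C m)ᶜ = ⋃ σ ∈ {σ : List α | W (m, σ)}, stringCylinder σ := by
    ext x
    simp only [C, W, Set.mem_compl_iff, Set.mem_ofPred_eq, Set.mem_iUnion, not_forall, not_not,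
      isWaitingTime_iff_exists_string]
    exact ⟨fun ⟨n, hn, σ, hσ, hx⟩ => ⟨σ, ⟨n, hn, hσ⟩, hx⟩,
      fun ⟨σ, ⟨n, hn, hσ⟩, hx⟩ => ⟨n, hn, σ, hσ, hx⟩⟩
  refine ⟨⋃ m, C m, ⟨C, ⟨W, rePredInSet_iff_exists.2 ⟨fun p n => decide (p.1 ≤ n) &&
    decide (n + f n + 1 ≤ p.2.length) && decide ((p.2.drop n).idxOf a = f n), ?_, ?_⟩, hC⟩,
    fun m => (isNowhereDense_iff_of_compl_eq (hC m)).2 fun σ => ?_, subset_rfl⟩,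
    fun x hx => Set.mem_iUnion.2 (exists_forall_not_isWaitingTime hf hx)⟩
  · have hf' : ComputableIn {oracleOf A} f := hfA
    exact computableIn_and (by fun_prop) (computableIn_decide_eq (by fun_prop) (by fun_prop))
  · simp [W, and_assoc]
  · obtain ⟨n, hmn, hσn⟩ : ∃ n, m ≤ n ∧ σ.length ≤ n := ⟨_, le_max_left _ _, le_max_right _ _⟩
    refine ⟨_, getD_mem_stringCylinder σ fun i => if i = n + f n then a else b, fun hx =>
      hx n hmn ⟨?_, fun i hi => ?_⟩⟩
    · simp [List.getElem?_eq_none (show σ.length ≤ n + f n by omega)]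
    · simp [List.getElem?_eq_none (show σ.length ≤ n + i by omega), hi.ne, hab.symm]

end Engulfing

section FreshKeys

variable {κ γ : Type*} [DecidableEq κ] {Z L : List (κ × γ)}

/-- Append to the association list `Z` the first pair of `L` whose key is not yet in use; this is
one step in the construction of a function from guesses at parts of its graph. -/
def appendFresh (Z L : List (κ × γ)) : List (κ × γ) :=
  Z ++ (L.find? fun a => (Z.lookup a.1).isNone).toList

theorem lookup_appendFresh_of_lookup_eq_some {k : κ} {v : γ} (h : Z.lookup k = some v) :
    (appendFresh Z L).lookup k = some v := by
  simp [appendFresh, List.lookup_append, h]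

theorem length_appendFresh_le : (appendFresh Z L).length ≤ Z.length + 1 := by
  simp [appendFresh, Option.length_toList_le]

theorem exists_lookup_appendFresh {a : κ × γ} (ha : a ∈ L) (hZ : Z.lookup a.1 = none) :
    ∃ b ∈ L, (appendFresh Z L).lookup b.1 = some b.2 := by
  obtain ⟨b, hb⟩ : ∃ b, L.find? (fun a => (Z.lookup a.1).isNone) = some b := by
    rw [← Option.isSome_iff_exists, List.find?_isSome]
    exact ⟨a, ha, by rw [hZ, Option.isNone_none]⟩
  have hnone : Z.lookup b.1 = none := by
    simpa only [Option.isNone_iff_eq_none] using List.find?_some hb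
  refine ⟨b, List.mem_of_find?_eq_some hb, ?_⟩
  simp [appendFresh, hb, List.lookup_append, hnone, List.lookup]

theorem exists_lookup_eq_none_of_injective {n : ℕ} (hZ : Z.length ≤ n) {c : ℕ → κ}
    (hc : Function.Injective c) : ∃ j ∈ Finset.range (n + 1), Z.lookup (c j) = none := by
  by_contra! h
  have hmaps : Set.MapsTo c (Finset.range (n + 1)) (Z.map Prod.fst).toFinset := by
    intro j hj
    obtain ⟨v, hv⟩ := Option.ne_none_iff_exists'.1 (h j hj)
    obtain ⟨l₁, l₂, rfl, -⟩ := List.lookup_eq_some_iff.1 hv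
    simp
  have hcard := Finset.card_le_card_of_injOn c hmaps hc.injOn
  have hkeys := List.toFinset_card_le (Z.map Prod.fst)
  simp only [Finset.card_range, List.length_map] at hcard hkeys
  omega

theorem primrec₂_appendFresh [Primcodable κ] [Primcodable γ] :
    Primrec₂ (appendFresh (κ := κ) (γ := γ)) := by
  have hrel : PrimrecRel fun (a : κ × γ) (Z : List (κ × γ)) => (Z.lookup a.1).isSome = false :=
    Primrec.eq.comp (Primrec.option_isSome.comp (Primrec.listLookup.comp
      (Primrec.fst.comp Primrec.fst) Primrec.snd)) (Primrec.const false)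
  refine (Primrec.list_append.comp Primrec.fst (Primrec.optionToList.comp
    (Primrec.list_head?.comp (hrel.listFilter.comp Primrec.snd Primrec.fst)))).of_eq fun q => ?_
  simp [appendFresh, List.head?_filter]

end FreshKeys

section ComputableGuesses

variable {O : Set (ℕ →. ℕ)} {γ : Type*} [Primcodable γ]

/-- Every function computable in the oracle set `O` agrees infinitely often with a computable
function. For the oracle of a set `A` this is the negation of `ComputesEventuallyDisagreeing A`. -/
def HasComputableGuesses (O : Set (ℕ →. ℕ)) : Prop :=
  ∀ f : ℕ → ℕ, ComputableIn O f → ∃ g : ℕ → ℕ, Computable g ∧ ∃ᶠ n in atTop, g n = f n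

theorem hasComputableGuesses_of_not_computesEventuallyDisagreeing {A : Set ℕ}
    (h : ¬ ComputesEventuallyDisagreeing A) : HasComputableGuesses {oracleOf A} := by
  intro f hf
  by_contra! hg
  exact h ⟨f, hf, fun g hg' => (hg g hg').mono fun _ => Ne.symm⟩

theorem HasComputableGuesses.exists_guess [Inhabited γ] (H : HasComputableGuesses O) {F : ℕ → γ}
    (hF : ComputableIn O F) : ∃ G : ℕ → γ, Computable G ∧ ∃ᶠ n in atTop, G n = F n := by
  obtain ⟨g, hg, hfreq⟩ := H (fun n => encode (F n)) (by fun_prop)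
  exact ⟨fun n => (decode (g n)).getD default,
    (Computable.decode.comp hg).option_getD (Computable.const _),
    hfreq.mono fun n hn => by simp [hn]⟩

theorem exists_computableIn_rec (a : γ) {h : ℕ → γ → γ} (hh : ComputableIn₂ O h) :
    ∃ f : ℕ → γ, ComputableIn O f ∧ f 0 = a ∧ ∀ n, f (n + 1) = h n (f n) := by
  have hh' : ComputableIn O fun q : ℕ × γ => h q.1 q.2 := hh
  exact ⟨fun n => Nat.rec (motive := fun _ => γ) a h n, by fun_prop, rfl, fun _ => rfl⟩

theorem pair_lt_succ_mul_succ {i j n : ℕ} (hi : i ≤ n) (hj : j ≤ n) :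
    Nat.pair i j < (n + 1) * (n + 1) :=
  calc Nat.pair i j < (max i j + 1) ^ 2 := Nat.pair_lt_max_add_one_sq i j
    _ ≤ (n + 1) ^ 2 := by gcongr; exact max_le hi hj
    _ = (n + 1) * (n + 1) := sq _

theorem exists_computableIn_monotone_bound {t : ℕ → ℕ → ℕ} (ht : ComputableIn₂ O t) :
    ∃ S : ℕ → ℕ, ComputableIn O S ∧ Monotone S ∧ ∀ n, ∀ i ≤ n, ∀ j ≤ n, t i j ≤ S n := by
  have ht' : ComputableIn O fun q : ℕ × ℕ => t q.1 q.2 := ht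
  obtain ⟨s, hs, -, hsucc⟩ := exists_computableIn_rec (O := O) 0
    (h := fun c m => max m (t c.unpair.1 c.unpair.2)) (by unfold ComputableIn₂; fun_prop)
  have hmono : Monotone s := monotone_nat_of_le_succ fun c => hsucc c ▸ le_max_left _ _
  have hbound (i j : ℕ) : t i j ≤ s (Nat.pair i j + 1) := by simp [hsucc]
  refine ⟨fun n => s ((n + 1) * (n + 1)), by fun_prop, fun m n hmn =>
    hmono (Nat.mul_le_mul (Nat.succ_le_succ hmn) (Nat.succ_le_succ hmn)), fun n i hi j hj => ?_⟩
  exact (hbound i j).trans (hmono (pair_lt_succ_mul_succ hi hj))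

theorem exists_computableIn_strictMono_enumeration {R : ℕ → Bool} (hR : ComputableIn O R)
    (hfreq : ∃ᶠ k in atTop, R k) :
    ∃ c : ℕ → ℕ, ComputableIn O c ∧ StrictMono c ∧ ∀ j, R (c j) := by
  obtain ⟨next, hnext, hspec⟩ := exists_computableIn_choice (O := O)
    (p := fun n k => decide (n ≤ k) && R k) (by unfold ComputableIn₂; fun_prop)
    (by simpa using! frequently_atTop.1 hfreq)
  simp only [Bool.and_eq_true, decide_eq_true_eq] at hspec
  obtain ⟨c, hc, hzero, hsucc⟩ := exists_computableIn_rec (O := O) (next 0)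
    (h := fun _ m => next (m + 1)) (by unfold ComputableIn₂; fun_prop)
  refine ⟨c, hc, strictMono_nat_of_lt_succ fun n => hsucc n ▸ (hspec _).1, fun j => ?_⟩
  cases j with
  | zero => exact hzero ▸ (hspec _).2
  | succ j => exact hsucc j ▸ (hspec _).2

theorem frequently_apply_le_succ_of_frequently_apply_apply_le {h S ν : ℕ → ℕ} (hh : Monotone h)
    (hS : Monotone S) (hν : StrictMono ν) (hsucc : ∀ k, ν (k + 1) = S (ν k)) (hzero : ν 0 = 0)
    (hfreq : ∃ᶠ n in atTop, h (h n) ≤ S n) : ∃ᶠ k in atTop, h (ν k) ≤ ν (k + 1) := by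
  refine frequently_atTop.2 fun N => ?_
  obtain ⟨n, hNn, hn⟩ := frequently_atTop.1 hfreq (ν N)
  obtain ⟨k, hk⟩ : ∃ k, ν k ≤ n ∧ n < ν (k + 1) :=
    ⟨Nat.findGreatest (fun k => ν k ≤ n) n,
      Nat.findGreatest_spec (P := fun k => ν k ≤ n) n.zero_le (hzero.trans_le n.zero_le),
      not_le.1 fun hle => (Nat.lt_succ_self _).not_ge
        (Nat.le_findGreatest ((hν.id_le _).trans hle) hle)⟩
  have hNk : N ≤ k := Nat.lt_succ_iff.1 (hν.lt_iff_lt.1 (hNn.trans_lt hk.2))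
  rcases le_or_gt (h (ν k)) (ν (k + 1)) with hle | hlt
  · exact ⟨k, hNk, hle⟩
  · refine ⟨k + 1, hNk.trans k.le_succ, ?_⟩
    calc h (ν (k + 1)) ≤ h (h n) := hh (hlt.le.trans (hh hk.1))
      _ ≤ S n := hn
      _ ≤ ν (k + 1 + 1) := hsucc (k + 1) ▸ hS hk.2.le

theorem HasComputableGuesses.exists_sparse (H : HasComputableGuesses O) {h : ℕ → ℕ}
    (hh : ComputableIn O h) (hmono : Monotone h) :
    ∃ ν : ℕ → ℕ, Computable ν ∧ StrictMono ν ∧ ∃ᶠ k in atTop, h (ν k) ≤ ν (k + 1) := by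
  obtain ⟨G, hG, hfreq⟩ := H (fun n => h (h n)) (by fun_prop)
  have hG' : ComputableIn ∅ G := hG.computableIn
  obtain ⟨S, hS, hSmono, hGS⟩ := exists_computableIn_monotone_bound (O := ∅)
    (t := fun i _ => G i + i + 1) (by unfold ComputableIn₂; fun_prop)
  obtain ⟨ν, hν, hzero, hsucc⟩ := exists_computableIn_rec (O := ∅) 0 (h := fun _ m => S m)
    (by unfold ComputableIn₂; fun_prop)
  have hGS' (n : ℕ) : G n + n + 1 ≤ S n := hGS n n le_rfl n le_rfl
  have hνmono : StrictMono ν := strictMono_nat_of_lt_succ fun k => by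
    have := hGS' (ν k)
    rw [hsucc]
    omega
  refine ⟨ν, recursiveIn_empty_iff.1 hν, hνmono,
    frequently_apply_le_succ_of_frequently_apply_apply_le hmono hSmono hνmono hsucc hzero
      (hfreq.mono fun n hn => ?_)⟩
  have := hGS' n
  omega

theorem HasComputableGuesses.exists_guess_on [Inhabited γ] (H : HasComputableGuesses O)
    {R : ℕ → Bool} (hR : ComputableIn O R) (hfreq : ∃ᶠ k in atTop, R k) {F : ℕ → γ}
    (hF : ComputableIn O F) : ∃ g : ℕ → γ, Computable g ∧ ∃ᶠ k in atTop, R k ∧ g k = F k := by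
  obtain ⟨c, hc, hcmono, hRc⟩ := exists_computableIn_strictMono_enumeration hR hfreq
  obtain ⟨G, hG, hGfreq⟩ := H.exists_guess (F := fun n => (List.range (n + 1)).map fun j =>
    (c (n + j), F (c (n + j)))) (by fun_prop)
  have hG' : ComputableIn ∅ G := hG.computableIn
  obtain ⟨Z, hZ, hzero, hsucc⟩ := exists_computableIn_rec (O := ∅) []
    (h := fun n Z => appendFresh Z (G n))
    (computableIn_primrec₂ primrec₂_appendFresh (by fun_prop) (by fun_prop))
  have hlen (n : ℕ) : (Z n).length ≤ n := by
    induction n with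
    | zero => simp [hzero]
    | succ n ih => exact hsucc n ▸ length_appendFresh_le.trans (Nat.succ_le_succ ih)
  have hpersist {k v m n} (hmn : m ≤ n) (hm : (Z m).lookup k = some v) :
      (Z n).lookup k = some v := by
    induction hmn with
    | refl => exact hm
    | step _ ih => exact hsucc _ ▸ lookup_appendFresh_of_lookup_eq_some ih
  have hg : ComputableIn ∅ fun k => ((Z (k + 1)).lookup k).getD default := by fun_prop
  refine ⟨_, recursiveIn_empty_iff.1 hg, frequently_atTop.2 fun N => ?_⟩
  obtain ⟨n, hn, hGn⟩ := frequently_atTop.1 hGfreq N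
  obtain ⟨j, hj, hjZ⟩ := exists_lookup_eq_none_of_injective (hlen n)
    (hcmono.injective.comp (add_right_injective n))
  obtain ⟨b, hb, hbZ⟩ := exists_lookup_appendFresh (L := G n)
    (hGn ▸ List.mem_map_of_mem (by simpa using hj)) hjZ
  rw [hGn] at hb
  obtain ⟨i, -, rfl⟩ := List.mem_map.1 hb
  have hni : n ≤ c (n + i) := (Nat.le_add_right n i).trans (hcmono.id_le _)
  refine ⟨c (n + i), hn.trans hni, hRc _, ?_⟩
  rw [hpersist (Nat.succ_le_succ hni) (hsucc n ▸ hbZ), Option.getD_some]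

end ComputableGuesses

section Extension

variable {α : Type*} [Primcodable α] {A : Set ℕ} {W : ℕ × List α → Prop}

theorem exists_computableIn_extension [Nonempty α] (hW : REPredInSet A W)
    (hdense : ∀ m σ, ∃ ρ τ, W (m, ρ) ∧ ρ <+: σ ++ τ) :
    ∃ e : ℕ × List α → List α, ComputableIn {oracleOf A} e ∧
      ∀ q, ∃ ρ, W (q.1, ρ) ∧ ρ <+: q.2 ++ e q := by
  obtain ⟨R, hR, hWR⟩ := rePredInSet_iff_exists.1 hW
  have hR' : ComputableIn {oracleOf A} fun q : (ℕ × List α) × ℕ => R q.1 q.2 := hR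
  obtain ⟨f, hf, hspec⟩ := exists_computableIn_choice (O := {oracleOf A})
    (p := fun (q : ℕ × List α) (t : List α × ℕ × ℕ) => R (q.1, (q.2 ++ t.1).take t.2.1) t.2.2)
    (by unfold ComputableIn₂; fun_prop) fun q => by
      obtain ⟨ρ, τ, hρ, hpre⟩ := hdense q.1 q.2
      obtain ⟨s, hs⟩ := (hWR _).1 hρ
      exact ⟨(τ, ρ.length, s), (List.prefix_iff_eq_take.1 hpre) ▸ hs⟩
  exact ⟨fun q => (f q).1, by fun_prop,
    fun q => ⟨_, (hWR _).2 ⟨_, hspec q⟩, List.take_prefix _ _⟩⟩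

theorem exists_universal_extension [Nonempty α] (hW : REPredInSet A W)
    (hdense : ∀ m σ, ∃ ρ τ, W (m, ρ) ∧ ρ <+: σ ++ τ) :
    ∃ T : ℕ → List α, ComputableIn {oracleOf A} T ∧ (∀ n, T n ≠ []) ∧
      ∀ n, ∀ m ≤ n, ∀ σ : List α, encode σ ≤ n → ∃ ρ, W (m, ρ) ∧ ρ <+: σ ++ T n := by
  obtain ⟨e, he, hspec⟩ := exists_computableIn_extension hW hdense
  obtain ⟨a⟩ := ‹Nonempty α›
  obtain ⟨u, hu, hzero, hsucc⟩ := exists_computableIn_rec (O := {oracleOf A}) [a]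
    (h := fun i υ => υ ++ e (((decode (α := ℕ × List α) i).getD (0, [])).1,
      ((decode (α := ℕ × List α) i).getD (0, [])).2 ++ υ)) (by unfold ComputableIn₂; fun_prop)
  have hmono {i j : ℕ} (hij : i ≤ j) : u i <+: u j :=
    Nat.le_induction List.prefix_rfl
      (fun j _ ih => ih.trans (hsucc j ▸ List.prefix_append _ _)) j hij
  refine ⟨fun n => u ((n + 1) * (n + 1)), by fun_prop, fun n hn => ?_, fun n m hm σ hσ => ?_⟩
  · simpa [hzero, hn] using hmono (Nat.zero_le ((n + 1) * (n + 1)))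
  · obtain ⟨ρ, hρ, hpre⟩ := hspec (m, σ ++ u (encode (m, σ)))
    refine ⟨ρ, hρ, hpre.trans ?_⟩
    have hstep : u (encode (m, σ) + 1) =
        u (encode (m, σ)) ++ e (m, σ ++ u (encode (m, σ))) := by
      rw [hsucc, encodek, Option.getD_some]
    rw [List.append_assoc, ← hstep, List.prefix_append_right_inj]
    exact hmono (pair_lt_succ_mul_succ hm hσ)

theorem exists_bounded_chain {g : ℕ → List α} {ν : ℕ → ℕ} (hg : Computable g) (hν : Computable ν)
    (hmono : Monotone ν) : ∃ p : ℕ → List α, Computable p ∧ (∀ k, p k <+: p (k + 1)) ∧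
      (∀ k, encode (p k) ≤ ν k) ∧
      ∀ k, encode (p k ++ g k) ≤ ν (k + 1) → p (k + 1) = p k ++ g k := by
  have hg' : ComputableIn ∅ g := hg.computableIn
  have hν' : ComputableIn ∅ ν := hν.computableIn
  obtain ⟨p, hp, hzero, hsucc⟩ := exists_computableIn_rec (O := ∅) []
    (h := fun k q => if encode (q ++ g k) ≤ ν (k + 1) then q ++ g k else q)
    (by unfold ComputableIn₂; fun_prop)
  refine ⟨p, recursiveIn_empty_iff.1 hp, fun k => ?_, fun k => ?_, fun k hk => by
    rw [hsucc, if_pos hk]⟩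
  · rw [hsucc]
    split_ifs
    exacts [List.prefix_append _ _, List.prefix_rfl]
  · induction k with
    | zero => simp [hzero]
    | succ k ih =>
      rw [hsucc]
      split_ifs with h
      exacts [h, ih.trans (hmono k.le_succ)]

theorem exists_computable_of_prefix_chain [Nonempty α] {p : ℕ → List α} (hp : Computable p)
    (hpre : ∀ k, p k <+: p (k + 1)) (hlen : ∃ᶠ k in atTop, (p k).length < (p (k + 1)).length) :
    ∃ x : ℕ → α, Computable x ∧ ∀ k, x ∈ stringCylinder (p k) := by
  have hmono {k l : ℕ} (hkl : k ≤ l) : p k <+: p l :=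
    Nat.le_induction List.prefix_rfl (fun l _ ih => ih.trans (hpre l)) l hkl
  have hunbounded (n : ℕ) : ∃ k, n + 1 ≤ (p k).length := by
    induction n with
    | zero => exact hlen.exists.imp' Nat.succ fun k hk => Nat.one_le_of_lt hk
    | succ n ih =>
      obtain ⟨k, hk⟩ := ih
      obtain ⟨l, hkl, hl⟩ := frequently_atTop.1 hlen k
      exact ⟨l + 1, (Nat.succ_le_succ (hk.trans (hmono hkl).length_le)).trans hl⟩
  have hp' : ComputableIn ∅ p := hp.computableIn
  obtain ⟨κ, hκ, hspec⟩ := exists_computableIn_choice (O := ∅)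
    (p := fun i k => decide (i + 1 ≤ (p k).length)) (by unfold ComputableIn₂; fun_prop)
    (by simpa using! hunbounded)
  simp only [decide_eq_true_eq] at hspec
  obtain ⟨a⟩ := ‹Nonempty α›
  refine ⟨fun i => (p (κ i)).getD i a, ?_, fun k i hi => ?_⟩
  · exact (Primrec.list_getD a).to_comp.comp (hp.comp (recursiveIn_empty_iff.1 hκ)) Computable.id
  · dsimp only
    rw [List.getD_eq_getElem _ _ (hspec i)]
    rcases le_total k (κ i) with h | h
    · exact ((hmono h).getElem hi).symm
    · exact (hmono h).getElem (hspec i)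

theorem HasComputableGuesses.exists_computable_extending [Nonempty α] {O : Set (ℕ →. ℕ)}
    (H : HasComputableGuesses O) {T : ℕ → List α} (hT : ComputableIn O T) (hne : ∀ n, T n ≠ []) :
    ∃ x : ℕ → α, Computable x ∧
      ∃ᶠ n in atTop, ∃ σ, encode σ ≤ n ∧ x ∈ stringCylinder (σ ++ T n) := by
  obtain ⟨h, hh, hmono, hbound⟩ := exists_computableIn_monotone_bound (O := O)
    (t := fun i n => encode ((decode (α := List α) i).getD [] ++ T n))
    (by unfold ComputableIn₂; fun_prop)
  obtain ⟨ν, hν, hνmono, hfreq⟩ := H.exists_sparse hh hmono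
  have hν' : ComputableIn O ν := hν.computableIn
  obtain ⟨g, hg, hgfreq⟩ := H.exists_guess_on (R := fun k => decide (h (ν k) ≤ ν (k + 1)))
    (by fun_prop) (by simpa using hfreq) (F := fun k => T (ν k)) (by fun_prop)
  obtain ⟨p, hp, hpre, henc, hstep⟩ := exists_bounded_chain hg hν hνmono.monotone
  have hgood : ∃ᶠ k in atTop, p (k + 1) = p k ++ T (ν k) := by
    refine hgfreq.mono fun k ⟨hk, hgk⟩ => hgk ▸ hstep k ?_
    have := hbound (ν k) _ (henc k) _ le_rfl
    rw [encodek, Option.getD_some, ← hgk] at this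
    exact this.trans (of_decide_eq_true hk)
  obtain ⟨x, hx, hxp⟩ := exists_computable_of_prefix_chain hp hpre (hgood.mono fun k hk => by
    simpa [hk, List.length_pos_iff] using hne (ν k))
  exact ⟨x, hx, hνmono.tendsto_atTop.frequently
    (hgood.mono fun k hk => ⟨p k, henc k, hk ▸ hxp (k + 1)⟩)⟩

theorem WeaklyMeagerEngulfing.computesEventuallyDisagreeing [Nonempty α] [TopologicalSpace α]
    [DiscreteTopology α] (h : WeaklyMeagerEngulfing α A) : ComputesEventuallyDisagreeing A := by
  by_contra hA
  obtain ⟨S, ⟨C, ⟨W, hW, hC⟩, hnd, hS⟩, hall⟩ := h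
  have hmem {m : ℕ} {x : ℕ → α} : x ∉ C m ↔ ∃ ρ, W (m, ρ) ∧ x ∈ stringCylinder ρ := by
    rw [← Set.mem_compl_iff, hC m]
    simp
  obtain ⟨T, hT, hne, huniv⟩ := exists_universal_extension hW fun m σ => by
    obtain ⟨x, hxσ, hxC⟩ := (isNowhereDense_iff_of_compl_eq (hC m)).1 (hnd m) σ
    obtain ⟨ρ, hρ, hxρ⟩ := hmem.1 hxC
    exact ⟨ρ, (exists_isPrefix_append_of_mem_stringCylinder hxσ hxρ).imp fun _ => And.intro hρ⟩
  obtain ⟨x, hx, hfreq⟩ := (hasComputableGuesses_of_not_computesEventuallyDisagreeing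
    hA).exists_computable_extending hT hne
  obtain ⟨m, hm⟩ := Set.mem_iUnion.1 (hS (hall x hx))
  obtain ⟨n, hmn, σ, hσ, hxσ⟩ := frequently_atTop.1 hfreq m
  obtain ⟨ρ, hρ, hpre⟩ := huniv n m hmn σ hσ
  exact hmem.2 ⟨ρ, hρ, stringCylinder_anti hpre hxσ⟩ hm

end Extension

theorem theorem4p3_general {α : Type*} [Primcodable α] [Nontrivial α] [TopologicalSpace α]
    [DiscreteTopology α] (A : Set ℕ) :
    ComputesEventuallyDisagreeing A ↔ WeaklyMeagerEngulfing α A :=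
  ⟨ComputesEventuallyDisagreeing.weaklyMeagerEngulfing,
    WeaklyMeagerEngulfing.computesEventuallyDisagreeing⟩

theorem theorem4p3 (A : Set ℕ) :
    List.TFAE [
      ComputesEventuallyDisagreeing A,
      WeaklyMeagerEngulfing Bool A,
      WeaklyMeagerEngulfing ℕ A] := by
  tfae_have 1 ↔ 2 := theorem4p3_general A
  tfae_have 1 ↔ 3 := theorem4p3_general A
  tfae_finish
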